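/- Let $n\ge 1$, let $\Omega\subset\mathbb C^n$ be a bounded pseudoconvex domain on which $|z_1|<e^{-1}$, let $\gamma\in[0,1)$, let $d\lambda$ be Lebesgue measure, and put $$d\mu_\gamma=\frac{d\lambda}{|z_1|^2\,(\log|z_1|^{-2})^{2-\gamma}}\quad\text{on }\Omega .$$ Let $\varphi_j$ $(j\in\mathbb N)$ and $\varphi$ be plurisubharmonic functions on $\Omega$ (upper semicontinuous with values in $[-\infty,\infty)$, not identically $-\infty$) such that $\varphi_j\to\varphi$ in $L^1_{loc}(\Omega,d\lambda)$ (in particular this holds if $\varphi_j\to\varphi$ in $L^1(\Omega,d\lambda)$). Assume that there is $\alpha>0$ such that for every open set $E\Subset\Omega$ there is a constant $C>0$ with $$\int_E e^{-\alpha\varphi_j}\,d\mu_\gamma<C\qquad\text{for all } j .$$ Then, for every real $p\ge 1$, $\varphi_j\to\varphi$ in $L^p_{loc}(\Omega,d\mu_\gamma)$; that is, for every compact $K\subset\Omega$, the integrals $\int_K|\varphi_j|^p\,d\mu_\gamma$ and $\int_K|\varphi|^p\,d\mu_\gamma$ are finite and $\int_K|\varphi_j-\varphi|^p\,d\mu_\gamma\to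 0$ as $j\to\infty$. -/

import Mathlib

open MeasureTheory Filter Topology

noncomputable section

namespace LocalLp

/-- The integral `∫ f⁺ dμ - ∫ f⁻ dμ ∈ [-∞, ∞]` of an extended real valued function. It is used below
only for functions that are bounded above on a finite measure space, where `∫ f⁺ dμ` is finite. -/
def eintegral {X : Type*} [MeasurableSpace X] (μ : Measure X) (f : X → EReal) : EReal :=
  ((∫⁻ x, (f x).toENNReal ∂μ : ENNReal) : EReal) - ((∫⁻ x, (-f x).toENNReal ∂μ : ENNReal) : EReal)

/-- The normalized (probability) Lebesgue measure `dθ / 2π` on `(0, 2π]`. -/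
def angleMeasure : Measure ℝ :=
  (ENNReal.ofReal (2 * Real.pi))⁻¹ • (volume.restrict (Set.Ioc 0 (2 * Real.pi)))

/-- Plurisubharmonic functions `φ : Ω → [-∞, ∞)` on a domain `Ω ⊆ ℂⁿ`: upper semicontinuous, not
identically `-∞`, with the sub-mean value inequality
`φ a ≤ (1 / 2π) ∫₀^{2π} φ (a + e^{iθ} b) dθ` whenever the closed disc `{a + ζ b : |ζ| ≤ 1}` lies
in `Ω`. (Values of `φ` outside `Ω` are irrelevant.) -/
structure IsPSH {n : ℕ} (φ : (Fin n → ℂ) → EReal) (Ω : Set (Fin n → ℂ)) : Prop where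
  lt_top : ∀ z ∈ Ω, φ z < ⊤
  usc : UpperSemicontinuousOn φ Ω
  not_bot : ∃ z ∈ Ω, φ z ≠ ⊥
  submean : ∀ a b : Fin n → ℂ, (∀ ζ : ℂ, ‖ζ‖ ≤ 1 → a + ζ • b ∈ Ω) →
    φ a ≤ eintegral angleMeasure (fun θ : ℝ => φ (a + Complex.exp (θ * Complex.I) • b))

/-- A domain is pseudoconvex if it carries a continuous plurisubharmonic exhaustion function. -/
def IsPseudoconvex {n : ℕ} (Ω : Set (Fin n → ℂ)) : Prop :=
  ∃ ρ : (Fin n → ℂ) → ℝ, ContinuousOn ρ Ω ∧ IsPSH (fun z => (ρ z : EReal)) Ω ∧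
    ∀ c : ℝ, IsCompact {z | z ∈ Ω ∧ ρ z ≤ c}

/-- The measure `dμ_γ = dλ / (|z₁|² (log |z₁|⁻²)^(2 - γ))` on `Ω`; the first coordinate `z₁` is
`z 0`, and `dλ` is Lebesgue measure. -/
def muGamma {n : ℕ} [NeZero n] (Ω : Set (Fin n → ℂ)) (γ : ℝ) : Measure (Fin n → ℂ) :=
  (volume.restrict Ω).withDensity fun z =>
    ENNReal.ofReal (1 / (‖z 0‖ ^ 2 * Real.log ((‖z 0‖ ^ 2)⁻¹) ^ (2 - γ)))

/-- `f ∈ L^p_loc(Ω, μ)`, for extended real valued `f`; the absolute value is `[0, ∞]`-valued,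
so `f` is then finite almost everywhere. -/
def MemLpLoc {n : ℕ} (f : (Fin n → ℂ) → EReal) (p : ℝ) (μ : Measure (Fin n → ℂ))
    (Ω : Set (Fin n → ℂ)) : Prop :=
  ∀ K : Set (Fin n → ℂ), IsCompact K → K ⊆ Ω →
    AEMeasurable f (μ.restrict K) ∧ ∫⁻ z in K, (f z).abs ^ p ∂μ < ⊤

/-- `f_j → f` in `L^p_loc(Ω, μ)`: all functions are in `L^p_loc(Ω, μ)` and `∫_K |f_j - f|^p dμ → 0`
for every compact `K ⊆ Ω`. As `|±∞| = ∞`, the value of `f_j - f` where both are `-∞` is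
immaterial: this is a null set. -/
def TendstoLpLoc {n : ℕ} (f : ℕ → (Fin n → ℂ) → EReal) (g : (Fin n → ℂ) → EReal) (p : ℝ)
    (μ : Measure (Fin n → ℂ)) (Ω : Set (Fin n → ℂ)) : Prop :=
  (∀ j, MemLpLoc (f j) p μ Ω) ∧ MemLpLoc g p μ Ω ∧
    ∀ K : Set (Fin n → ℂ), IsCompact K → K ⊆ Ω →
      Tendsto (fun j => ∫⁻ z in K, (f j z - g z).abs ^ p ∂μ) atTop (𝓝 0)

end LocalLp

end

/-! ### Uniform upper bounds from the sub-mean value inequality. -/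

namespace LocalLp

/-! Convergence in `L¹_loc` bounds the `φ_j` in `L¹` on compact sets, and averaging the sub-mean
value inequality over polydiscs turns this into a uniform upper bound on `K`
(`exists_toENNReal_le_of_lintegral_abs_le`). Large negative values are absorbed by the exponential,
as `t ^ q ≤ c * exp (α * t)`; the integral hypothesis thus bounds every `L^q(μ_γ)` norm on `K`. The
upper bound also keeps `e^{-αφ_j}` away from `0`, so `μ_γ(K)` is finite (`lintegral_abs_rpow_le`).
Since `μ_γ` on `K` is finite with a Lebesgue density, `L¹(dλ)` convergence gives convergence in
`μ_γ`-measure. A Fatou argument passes the bounds to `φ`, and the `L^(p+1)` bound upgrades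
convergence in measure to `L^p` (`lintegral_rpow_lt_top_and_tendsto`). -/

lemma EReal_toENNReal_le_abs (x : EReal) : x.toENNReal ≤ x.abs := by
  induction x with
  | bot => simp
  | top => simp
  | coe x =>
    rw [EReal.real_coe_toENNReal, EReal.abs_def]
    exact ENNReal.ofReal_le_ofReal (le_abs_self x)

lemma toENNReal_eintegral_le {X : Type*} [MeasurableSpace X] (μ : Measure X) (f : X → EReal) :
    (eintegral μ f).toENNReal ≤ ∫⁻ x, (f x).toENNReal ∂μ := by
  rw [eintegral, EReal.toENNReal_sub (EReal.coe_ennreal_nonneg _), EReal.toENNReal_coe,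
    EReal.toENNReal_coe]
  exact tsub_le_self

lemma angleMeasure_univ : angleMeasure Set.univ = 1 := by
  have h : 0 < 2 * Real.pi := by positivity
  simp only [angleMeasure, Measure.smul_apply, Measure.restrict_apply_univ, Real.volume_Ioc,
    sub_zero, smul_eq_mul]
  exact ENNReal.inv_mul_cancel (by simpa using Real.pi_pos) ENNReal.ofReal_ne_top

instance : IsProbabilityMeasure angleMeasure := ⟨angleMeasure_univ⟩

lemma measurePreserving_circle_smul {ι : Type*} [Fintype ι] (c : Circle) :
    MeasurePreserving (fun z : ι → ℂ => (c : ℂ) • z) :=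
  volume_preserving_pi fun _ => (rotation c).measurePreserving

/-- The positive part of an upper semicontinuous function on an open set, extended by zero from a
measurable subset, is measurable. -/
lemma measurable_indicator_toENNReal {X : Type*} [TopologicalSpace X] [MeasurableSpace X]
    [BorelSpace X] {φ : X → EReal} {Ω K : Set X} (hΩ : IsOpen Ω)
    (hφ : UpperSemicontinuousOn φ Ω) (hK : MeasurableSet K) (hKΩ : K ⊆ Ω) :
    Measurable (K.indicator fun z => (φ z).toENNReal) := by
  classical
  have h : Measurable (Ω.piecewise φ fun _ => ⊥) := by
    refine measurable_of_Iio fun c => ?_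
    obtain ⟨u, hu, hu'⟩ := upperSemicontinuousOn_iff_preimage_Iio.1 hφ c
    rw [Set.piecewise_preimage, Set.ite, Set.inter_comm, hu']
    refine (hΩ.measurableSet.inter hu.measurableSet).union (MeasurableSet.diff ?_ hΩ.measurableSet)
    exact measurable_const measurableSet_Iio
  have h2 : (K.indicator fun z => (φ z).toENNReal) =
      K.indicator fun z => (Ω.piecewise φ (fun _ => ⊥) z).toENNReal := by
    refine Set.indicator_congr fun z hz => ?_
    simp [hKΩ hz]
  rw [h2]
  exact h.ereal_toENNReal.indicator hK

/-- The sub-mean value inequality over polydiscs, for the positive part. -/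
lemma IsPSH.volume_closedBall_mul_le {n : ℕ} {φ : (Fin n → ℂ) → EReal} {Ω K : Set (Fin n → ℂ)}
    (hφ : IsPSH φ Ω) (hΩ : IsOpen Ω) (hK : MeasurableSet K) (hKΩ : K ⊆ Ω) {a : Fin n → ℂ} {r : ℝ}
    (ha : Metric.closedBall a r ⊆ K) :
    volume (Metric.closedBall (0 : Fin n → ℂ) r) * (φ a).toENNReal ≤ ∫⁻ z in K, (φ z).abs := by
  set u : (Fin n → ℂ) → ENNReal := K.indicator fun z => (φ z).toENNReal with hu_def
  have hu : Measurable u := measurable_indicator_toENNReal hΩ hφ.usc hK hKΩ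
  set B := Metric.closedBall (0 : Fin n → ℂ) r
  have hmem : ∀ b ∈ B, ∀ ζ : ℂ, ‖ζ‖ ≤ 1 → a + ζ • b ∈ K := by
    intro b hb ζ hζ
    apply ha
    have hb : ‖b‖ ≤ r := by simpa [B] using hb
    rw [mem_closedBall_iff_norm, add_sub_cancel_left, norm_smul]
    exact (mul_le_of_le_one_left (norm_nonneg b) hζ).trans hb
  have hsub : ∀ b ∈ B, (φ a).toENNReal ≤
      ∫⁻ θ, u (a + Complex.exp (θ * Complex.I) • b) ∂angleMeasure := by
    intro b hb
    refine (EReal.toENNReal_le_toENNReal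
      (hφ.submean a b fun ζ hζ => hKΩ (hmem b hb ζ hζ))).trans ?_
    refine (toENNReal_eintegral_le _ _).trans (lintegral_mono fun θ => ?_)
    rw [hu_def, Set.indicator_of_mem (hmem b hb _ (Complex.norm_exp_ofReal_mul_I θ).le)]
  -- Integrate the disc inequality over all `b` in the polydisc and swap: for fixed `θ`, `b ↦ a +
  -- e^{iθ} b` preserves volume, so the `θ`-average disappears.
  calc volume B * (φ a).toENNReal
      = ∫⁻ _ in B, (φ a).toENNReal := by rw [setLIntegral_const, mul_comm]
    _ ≤ ∫⁻ b in B, ∫⁻ θ, u (a + Complex.exp (θ * Complex.I) • b) ∂angleMeasure :=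
        setLIntegral_mono' Metric.isClosed_closedBall.measurableSet hsub
    _ ≤ ∫⁻ b, ∫⁻ θ, u (a + Complex.exp (θ * Complex.I) • b) ∂angleMeasure :=
        setLIntegral_le_lintegral _ _
    _ = ∫⁻ θ : ℝ, (∫⁻ b, u (a + Complex.exp (θ * Complex.I) • b)) ∂angleMeasure := by
        refine lintegral_lintegral_swap (Measurable.aemeasurable ?_)
        refine hu.comp (Continuous.measurable ?_)
        fun_prop
    _ = ∫⁻ _ : ℝ, (∫⁻ z, u z) ∂angleMeasure := by
        refine lintegral_congr fun θ => ?_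
        have h := (measurePreserving_circle_smul (ι := Fin n) (Circle.exp θ)).lintegral_comp
          (f := fun z => u (a + z)) (by fun_prop)
        rw [Circle.coe_exp] at h
        rw [h, lintegral_add_left_eq_self]
    _ = ∫⁻ z, u z := by simp
    _ = ∫⁻ z in K, (φ z).toENNReal := lintegral_indicator hK _
    _ ≤ ∫⁻ z in K, (φ z).abs := lintegral_mono fun z => EReal_toENNReal_le_abs _

/-- Plurisubharmonic functions that are bounded in `L¹_loc` are locally uniformly bounded above. -/
lemma exists_toENNReal_le_of_lintegral_abs_le {ι : Type*} {n : ℕ} {φ : ι → (Fin n → ℂ) → EReal}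
    {Ω K : Set (Fin n → ℂ)} (hφ : ∀ i, IsPSH (φ i) Ω) (hΩ : IsOpen Ω) (hK : IsCompact K)
    (hKΩ : K ⊆ Ω)
    (hb : ∀ L : Set (Fin n → ℂ), IsCompact L → L ⊆ Ω →
      ∃ M : ENNReal, M ≠ ⊤ ∧ ∀ i, ∫⁻ z in L, (φ i z).abs ≤ M) :
    ∃ M : ENNReal, M ≠ ⊤ ∧ ∀ i, ∀ z ∈ K, (φ i z).toENNReal ≤ M := by
  obtain ⟨r, hr, hrΩ⟩ := hK.exists_cthickening_subset_open hΩ hKΩ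
  obtain ⟨M, hM, hM'⟩ := hb _ hK.cthickening hrΩ
  have hpos : volume (Metric.closedBall (0 : Fin n → ℂ) r) ≠ 0 :=
    (Metric.measure_closedBall_pos _ _ hr).ne'
  refine ⟨M / volume (Metric.closedBall (0 : Fin n → ℂ) r), ENNReal.div_ne_top hM hpos,
    fun i z hz => ?_⟩
  rw [ENNReal.le_div_iff_mul_le (.inl hpos)
    (.inl (isCompact_closedBall _ _).measure_lt_top.ne), mul_comm]
  exact ((hφ i).volume_closedBall_mul_le hΩ hK.cthickening.measurableSet hrΩ
    (Metric.closedBall_subset_cthickening hz r)).trans (hM' i)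

end LocalLp

/-! ### From `L¹(ν)` to `L^p(w ν)` convergence. -/

section Vitali

open scoped ENNReal

variable {X : Type*} [MeasurableSpace X]

/-- The three terms cover `h < ε`, `ε ≤ h ≤ T` and `h ≥ T`; in the last range `h ^ p * T ≤ h ^ (p +
1)`. -/
lemma ENNReal.rpow_le_rpow_add_rpow_add_div {h ε T : ℝ≥0∞} (hT0 : T ≠ 0) (hT : T ≠ ⊤) {p : ℝ}
    (hp : 0 ≤ p) :
    h ^ p ≤ ε ^ p + {x : ℝ≥0∞ | ε ≤ x}.indicator (fun _ => T ^ p) h + h ^ (p + 1) / T := by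
  rcases lt_or_ge h ε with h1 | h1
  · exact (ENNReal.rpow_le_rpow h1.le hp).trans (by rw [add_assoc]; exact le_self_add)
  rcases le_total h T with h2 | h2
  · rw [Set.indicator_of_mem (by exact h1)]
    refine (ENNReal.rpow_le_rpow h2 hp).trans ?_
    rw [add_right_comm]
    exact le_add_self
  · refine le_trans ?_ le_add_self
    rw [ENNReal.le_div_iff_mul_le (.inl hT0) (.inl hT), ENNReal.rpow_add_of_nonneg _ _ hp zero_le_one,
      ENNReal.rpow_one]
    gcongr

/-- On a finite measure space, convergence to zero in measure and a bound in `L^(p+1)` give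
convergence to zero in `L^p`. -/
lemma tendsto_lintegral_rpow_zero {μ : Measure X} [IsFiniteMeasure μ] {h : ℕ → X → ℝ≥0∞}
    (hm : ∀ j, AEMeasurable (h j) μ)
    (hμ : ∀ ε : ℝ≥0∞, 0 < ε → Tendsto (fun j => μ {x | ε ≤ h j x}) atTop (𝓝 0))
    {p : ℝ} (hp : 0 < p) {M : ℝ≥0∞} (hM : M ≠ ⊤) (hb : ∀ j, ∫⁻ x, h j x ^ (p + 1) ∂μ ≤ M) :
    Tendsto (fun j => ∫⁻ x, h j x ^ p ∂μ) atTop (𝓝 0) := by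
  have key : ∀ (ε T : ℝ≥0∞), T ≠ 0 → T ≠ ⊤ → ∀ j, ∫⁻ x, h j x ^ p ∂μ ≤
      ε ^ p * μ Set.univ + T ^ p * μ {x | ε ≤ h j x} + M / T := by
    intro ε T hT0 hT j
    have hnull : NullMeasurableSet {x | ε ≤ h j x} μ :=
      (hm j).nullMeasurable measurableSet_Ici
    calc ∫⁻ x, h j x ^ p ∂μ
        ≤ ∫⁻ x, (ε ^ p + {x | ε ≤ h j x}.indicator (fun _ => T ^ p) x)
            + h j x ^ (p + 1) / T ∂μ :=
          lintegral_mono fun x => ENNReal.rpow_le_rpow_add_rpow_add_div hT0 hT hp.le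
      _ = ε ^ p * μ Set.univ + T ^ p * μ {x | ε ≤ h j x} + (∫⁻ x, h j x ^ (p + 1) ∂μ) / T := by
          rw [lintegral_add_right' _ (((hm j).pow_const _).div_const _),
            lintegral_add_left measurable_const, lintegral_const, lintegral_indicator_const₀ hnull]
          simp_rw [div_eq_mul_inv]
          rw [lintegral_mul_const'' _ ((hm j).pow_const _)]
      _ ≤ _ := by gcongr; exact hb j
  have hlim : ∀ ε T : ℝ≥0∞, 0 < ε → T ≠ 0 → T ≠ ⊤ →
      limsup (fun j => ∫⁻ x, h j x ^ p ∂μ) atTop ≤ ε ^ p * μ Set.univ + M / T := by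
    intro ε T hε hT0 hT
    have h1 : Tendsto (fun j => ε ^ p * μ Set.univ + T ^ p * μ {x | ε ≤ h j x} + M / T) atTop
        (𝓝 (ε ^ p * μ Set.univ + T ^ p * 0 + M / T)) :=
      (tendsto_const_nhds.add (ENNReal.Tendsto.const_mul (hμ ε hε)
        (.inr (ENNReal.rpow_ne_top_of_nonneg hp.le hT)))).add tendsto_const_nhds
    rw [mul_zero, add_zero] at h1
    rw [← h1.limsup_eq]
    exact limsup_le_limsup (Eventually.of_forall (key ε T hT0 hT))
  -- Take `ε = 1/(k+1)` and `T = k+1`; the shift keeps `ε` finite and `T` nonzero.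
  have h2 : Tendsto (fun k : ℕ => ((k : ℝ≥0∞) + 1)⁻¹ ^ p * μ Set.univ + M / ((k : ℝ≥0∞) + 1)) atTop
      (𝓝 (0 ^ p * μ Set.univ + M * 0)) := by
    have h3 : Tendsto (fun k : ℕ => ((k : ℝ≥0∞) + 1)⁻¹) atTop (𝓝 0) := by
      have := (tendsto_add_atTop_iff_nat 1).2 ENNReal.tendsto_inv_nat_nhds_zero
      simpa using this
    refine Tendsto.add ?_ ?_
    · exact ENNReal.Tendsto.mul_const ((ENNReal.continuous_rpow_const.tendsto 0).comp h3)
        (.inr (measure_ne_top _ _))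
    · simp_rw [div_eq_mul_inv]
      exact ENNReal.Tendsto.const_mul h3 (.inr hM)
  rw [ENNReal.zero_rpow_of_pos hp, zero_mul, mul_zero, add_zero] at h2
  have h4 : limsup (fun j => ∫⁻ x, h j x ^ p ∂μ) atTop ≤ 0 :=
    ge_of_tendsto' h2 fun k => hlim _ _ (ENNReal.inv_pos.2 (by finiteness)) (by simp) (by finiteness)
  exact tendsto_of_le_liminf_of_limsup_le (zero_le) h4

/-- Convergence in `L¹(ν)` implies convergence in measure for every finite measure that has a
density with respect to `ν`. -/
lemma tendsto_measure_withDensity_of_tendsto_lintegral {ν : Measure X} {w : X → ℝ≥0∞}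
    [IsFiniteMeasure (ν.withDensity w)] {h : ℕ → X → ℝ≥0∞} (hm : ∀ j, AEMeasurable (h j) ν)
    (hh : Tendsto (fun j => ∫⁻ x, h j x ∂ν) atTop (𝓝 0)) {ε : ℝ≥0∞} (hε : 0 < ε) :
    Tendsto (fun j => ν.withDensity w {x | ε ≤ h j x}) atTop (𝓝 0) := by
  -- Chebyshev needs a finite level; `{⊤ ≤ h}` lies in `{1 ≤ h}`.
  wlog hε' : ε ≠ ⊤ generalizing ε
  · push Not at hε'
    subst hε'
    refine tendsto_of_tendsto_of_tendsto_of_le_of_le tendsto_const_nhds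
      (this one_pos ENNReal.one_ne_top) (fun _ => zero_le) fun j => measure_mono fun x hx => ?_
    exact le_trans (le_top : (1 : ℝ≥0∞) ≤ ⊤) hx
  have hfin : ∫⁻ x, w x ∂ν ≠ ⊤ := by
    have := measure_ne_top (ν.withDensity w) Set.univ
    rwa [withDensity_apply _ MeasurableSet.univ, Measure.restrict_univ] at this
  have h1 : Tendsto (fun j => ν {x | ε ≤ h j x}) atTop (𝓝 0) := by
    have h2 : Tendsto (fun j => (∫⁻ x, h j x ∂ν) / ε) atTop (𝓝 (0 / ε)) :=
      ENNReal.Tendsto.div_const hh (.inr hε.ne')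
    rw [ENNReal.zero_div] at h2
    exact tendsto_of_tendsto_of_tendsto_of_le_of_le tendsto_const_nhds h2 (fun _ => zero_le)
      fun j => meas_ge_le_lintegral_div (hm j) hε.ne' hε'
  -- Absolute continuity of the integral of `w`.
  refine (tendsto_setLIntegral_zero hfin h1).congr fun j => ?_
  exact (withDensity_apply₀ _ ((hm j).nullMeasurable measurableSet_Ici)).symm

/-- A form of Fatou's lemma for convergence in measure. -/
lemma lintegral_rpow_le_of_le_add {μ : Measure X} {a h : ℕ → X → ℝ≥0∞} {g : X → ℝ≥0∞}
    (ha : ∀ j, AEMeasurable (a j) μ) (hm : ∀ j, AEMeasurable (h j) μ) (hg : AEMeasurable g μ)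
    (hμ : ∀ ε : ℝ≥0∞, 0 < ε → Tendsto (fun j => μ {x | ε ≤ h j x}) atTop (𝓝 0))
    (hle : ∀ j, ∀ᵐ x ∂μ, g x ≤ a j x + h j x) {q : ℝ} (hq : 0 ≤ q) {M : ℝ≥0∞}
    (hb : ∀ j, ∫⁻ x, a j x ^ q ∂μ ≤ M) : ∫⁻ x, g x ^ q ∂μ ≤ M := by
  -- Where `h j < ε`, the truncation minus `ε` is at most `a j`; elsewhere it is at most `T`, on a
  -- set of vanishing measure.
  have key : ∀ ε T : ℝ≥0∞, 0 < ε → T ≠ ⊤ → ∫⁻ x, (min (g x) T - ε) ^ q ∂μ ≤ M := by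
    intro ε T hε hT
    have hlim : Tendsto (fun j => M + T ^ q * μ {x | ε ≤ h j x}) atTop (𝓝 (M + T ^ q * 0)) :=
      tendsto_const_nhds.add (ENNReal.Tendsto.const_mul (hμ ε hε)
        (.inr (ENNReal.rpow_ne_top_of_nonneg hq hT)))
    rw [mul_zero, add_zero] at hlim
    refine ge_of_tendsto' hlim fun j => ?_
    have hnull : NullMeasurableSet {x | ε ≤ h j x} μ :=
      (hm j).nullMeasurable measurableSet_Ici
    calc ∫⁻ x, (min (g x) T - ε) ^ q ∂μ
        ≤ ∫⁻ x, a j x ^ q + {x | ε ≤ h j x}.indicator (fun _ => T ^ q) x ∂μ := by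
          refine lintegral_mono_ae ?_
          filter_upwards [hle j] with x hx
          by_cases hεx : ε ≤ h j x
          · rw [Set.indicator_of_mem (by exact hεx)]
            refine le_trans ?_ le_add_self
            exact ENNReal.rpow_le_rpow (tsub_le_self.trans (min_le_right _ _)) hq
          · refine le_trans ?_ le_self_add
            refine ENNReal.rpow_le_rpow (tsub_le_iff_right.2 ?_) hq
            exact (min_le_left _ _).trans (hx.trans (by gcongr; exact (not_le.1 hεx).le))
      _ ≤ M + T ^ q * μ {x | ε ≤ h j x} := by
          rw [lintegral_add_left' ((ha j).pow_const _), lintegral_indicator_const₀ hnull]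
          gcongr
          exact hb j
  have h1 : ∀ x, liminf (fun k : ℕ => (min (g x) k - (k : ℝ≥0∞)⁻¹) ^ q) atTop = g x ^ q := by
    intro x
    have h2 : Tendsto (fun k : ℕ => min (g x) k - (k : ℝ≥0∞)⁻¹) atTop (𝓝 (min (g x) ⊤ - 0)) :=
      ENNReal.Tendsto.sub (tendsto_const_nhds.min ENNReal.tendsto_nat_nhds_top)
        ENNReal.tendsto_inv_nat_nhds_zero (.inr ENNReal.zero_ne_top)
    rw [tsub_zero, min_top_right] at h2
    exact ((ENNReal.continuous_rpow_const.tendsto _).comp h2).liminf_eq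
  rw [← lintegral_congr h1]
  refine (lintegral_liminf_le' fun k =>
    ((hg.min aemeasurable_const).sub aemeasurable_const).pow_const q).trans ?_
  exact liminf_le_of_frequently_le' (Frequently.of_forall fun k =>
    key _ _ (ENNReal.inv_pos.2 (ENNReal.natCast_ne_top k)) (ENNReal.natCast_ne_top k))

/-- Convergence in `L¹(ν)` together with bounds in every `L^q(w ν)`, where `w ν` is finite, gives
convergence in every `L^p(w ν)`. -/
lemma lintegral_rpow_lt_top_and_tendsto {ν : Measure X} {w : X → ℝ≥0∞}
    [IsFiniteMeasure (ν.withDensity w)] {a h : ℕ → X → ℝ≥0∞} {g : X → ℝ≥0∞}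
    (ha : ∀ j, AEMeasurable (a j) ν) (hm : ∀ j, AEMeasurable (h j) ν) (hg : AEMeasurable g ν)
    (hh : Tendsto (fun j => ∫⁻ x, h j x ∂ν) atTop (𝓝 0))
    (hga : ∀ j, ∀ᵐ x ∂ν, g x ≤ a j x + h j x) (hha : ∀ j, ∀ᵐ x ∂ν, h j x ≤ a j x + g x)
    (hb : ∀ q : ℝ, 1 ≤ q → ∃ M : ℝ≥0∞, M ≠ ⊤ ∧ ∀ j, ∫⁻ x, a j x ^ q ∂ν.withDensity w ≤ M)
    {p : ℝ} (hp : 1 ≤ p) :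
    ∫⁻ x, g x ^ p ∂ν.withDensity w < ⊤ ∧
      Tendsto (fun j => ∫⁻ x, h j x ^ p ∂ν.withDensity w) atTop (𝓝 0) := by
  have hac : ν.withDensity w ≪ ν := withDensity_absolutelyContinuous ν w
  have hμ : ∀ ε : ℝ≥0∞, 0 < ε →
      Tendsto (fun j => ν.withDensity w {x | ε ≤ h j x}) atTop (𝓝 0) := fun ε hε =>
    tendsto_measure_withDensity_of_tendsto_lintegral hm hh hε
  have hgb : ∀ q : ℝ, 1 ≤ q → ∃ M : ℝ≥0∞, M ≠ ⊤ ∧ (∀ j, ∫⁻ x, a j x ^ q ∂ν.withDensity w ≤ M) ∧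
      ∫⁻ x, g x ^ q ∂ν.withDensity w ≤ M := by
    intro q hq
    obtain ⟨M, hM, hM'⟩ := hb q hq
    exact ⟨M, hM, hM', lintegral_rpow_le_of_le_add (fun j => (ha j).mono_ac hac)
      (fun j => (hm j).mono_ac hac) (hg.mono_ac hac) hμ (fun j => hac.ae_le (hga j))
      (zero_le_one.trans hq) hM'⟩
  constructor
  · obtain ⟨M, hM, -, h⟩ := hgb p hp
    exact h.trans_lt hM.lt_top
  · obtain ⟨M, hM, hMa, hMg⟩ := hgb (p + 1) (by linarith)
    refine tendsto_lintegral_rpow_zero (fun j => (hm j).mono_ac hac) hμ (by linarith)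
      -- The factor `2 ^ p` comes from convexity of `t ^ (p + 1)`.
      (M := 2 ^ p * (M + M)) (by finiteness) fun j => ?_
    calc ∫⁻ x, h j x ^ (p + 1) ∂ν.withDensity w
        ≤ ∫⁻ x, 2 ^ p * (a j x ^ (p + 1) + g x ^ (p + 1)) ∂ν.withDensity w := by
          refine lintegral_mono_ae ?_
          filter_upwards [hac.ae_le (hha j)] with x hx
          refine (ENNReal.rpow_le_rpow hx (by linarith)).trans ?_
          simpa using ENNReal.rpow_add_le_mul_rpow_add_rpow (a j x) (g x)
            (p := p + 1) (by linarith)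
      _ = 2 ^ p * (∫⁻ x, a j x ^ (p + 1) ∂ν.withDensity w
            + ∫⁻ x, g x ^ (p + 1) ∂ν.withDensity w) := by
          rw [lintegral_const_mul' _ _ (by finiteness),
            lintegral_add_right' _ ((hg.mono_ac hac).pow_const _)]
      _ ≤ _ := by gcongr; exact hMa j

end Vitali

/-! ### Exponential integrability and uniform `L^q` bounds. -/

namespace LocalLp

open scoped ENNReal

lemma measurable_EReal_abs : Measurable EReal.abs := by
  have h : EReal.abs = fun x : EReal => x.toENNReal + (-x).toENNReal := by
    funext x
    induction x with
    | bot => simp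
    | top => simp
    | coe x =>
      rw [← EReal.coe_neg, EReal.real_coe_toENNReal, EReal.real_coe_toENNReal, EReal.abs_def]
      rcases le_total 0 x with hx | hx
      · rw [abs_of_nonneg hx, ENNReal.ofReal_of_nonpos (neg_nonpos.2 hx), add_zero]
      · rw [abs_of_nonpos hx, ENNReal.ofReal_of_nonpos hx, zero_add]
  rw [h]
  exact measurable_ereal_toENNReal.add (measurable_ereal_toENNReal.comp measurable_neg)

/-- No exceptional set is needed: if either value is infinite, the right side is `⊤`. -/
lemma EReal_abs_le_abs_add_abs_sub (x y : EReal) : y.abs ≤ x.abs + (x - y).abs := by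
  induction x with
  | bot => simp
  | top => simp
  | coe x =>
    induction y with
    | bot => simp
    | top => simp
    | coe y =>
      rw [← EReal.coe_sub, EReal.abs_def, EReal.abs_def, EReal.abs_def,
        ← ENNReal.ofReal_add (abs_nonneg _) (abs_nonneg _)]
      refine ENNReal.ofReal_le_ofReal ?_
      simpa using abs_sub x (x - y)

lemma EReal_abs_sub_le (x y : EReal) : (x - y).abs ≤ x.abs + y.abs := by
  induction x with
  | bot => simp
  | top => simp
  | coe x =>
    induction y with
    | bot => simp
    | top => simp
    | coe y =>
      rw [← EReal.coe_sub, EReal.abs_def, EReal.abs_def, EReal.abs_def,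
        ← ENNReal.ofReal_add (abs_nonneg _) (abs_nonneg _)]
      exact ENNReal.ofReal_le_ofReal (abs_sub x y)

lemma EReal_abs_le_add_abs_sub (x y : EReal) : x.abs ≤ (x - y).abs + y.abs := by
  have h : x - y = -y - -x := by rw [sub_eq_add_neg, sub_eq_add_neg, neg_neg, add_comm]
  have h' := EReal_abs_le_abs_add_abs_sub (-y) (-x)
  rwa [EReal.abs_neg, EReal.abs_neg, ← h, add_comm] at h'

/-- This is `s ≤ exp s` at `s = α * t / q`, raised to the power `q`. -/
lemma rpow_le_mul_exp {α q t : ℝ} (hα : 0 < α) (hq : 0 < q) (ht : 0 ≤ t) :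
    t ^ q ≤ (q / α) ^ q * Real.exp (α * t) := by
  have h1 : α * t / q ≤ Real.exp (α * t / q) := by
    linarith [Real.add_one_le_exp (α * t / q)]
  have h2 : t = q / α * (α * t / q) := by field_simp
  calc t ^ q = (q / α) ^ q * (α * t / q) ^ q := by
        rw [← Real.mul_rpow (by positivity) (by positivity), ← h2]
    _ ≤ (q / α) ^ q * Real.exp (α * t / q) ^ q := by gcongr
    _ = (q / α) ^ q * Real.exp (α * t) := by
        rw [← Real.exp_mul, div_mul_cancel₀ _ hq.ne']

lemma EReal_abs_rpow_le {α q : ℝ} (hα : 0 < α) (hq : 0 < q) {M : ℝ≥0∞} (hM : M ≠ ⊤) {x : EReal}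
    (hx : x.toENNReal ≤ M) :
    x.abs ^ q ≤ M ^ q + ENNReal.ofReal ((q / α) ^ q) * EReal.exp (-((α : EReal) * x)) := by
  induction x with
  | bot =>
    rw [EReal.coe_mul_bot_of_pos hα, EReal.neg_bot, EReal.exp_top, ENNReal.mul_top, add_top]
    · exact le_top
    · simpa using by positivity
  | top => simp [hM] at hx
  | coe x =>
    rw [← EReal.coe_mul, ← EReal.coe_neg, EReal.exp_coe, EReal.abs_def]
    rw [EReal.real_coe_toENNReal] at hx
    rcases le_total 0 x with h | h
    · rw [abs_of_nonneg h]
      exact (ENNReal.rpow_le_rpow hx hq.le).trans le_self_add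
    · refine le_trans ?_ le_add_self
      rw [abs_of_nonpos h, ENNReal.ofReal_rpow_of_nonneg (neg_nonneg.2 h) hq.le,
        ← ENNReal.ofReal_mul (by positivity)]
      refine ENNReal.ofReal_le_ofReal ?_
      simpa using rpow_le_mul_exp hα hq (neg_nonneg.2 h)

lemma ofReal_exp_neg_le {α : ℝ} (hα : 0 < α) {M : ℝ≥0∞} (hM : M ≠ ⊤) {x : EReal}
    (hx : x.toENNReal ≤ M) :
    ENNReal.ofReal (Real.exp (-(α * M.toReal))) ≤ EReal.exp (-((α : EReal) * x)) := by
  induction x with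
  | bot => rw [EReal.coe_mul_bot_of_pos hα, EReal.neg_bot, EReal.exp_top]; exact le_top
  | top => simp [hM] at hx
  | coe x =>
    rw [← EReal.coe_mul, ← EReal.coe_neg, EReal.exp_coe]
    rw [EReal.real_coe_toENNReal, ENNReal.ofReal_le_iff_le_toReal hM] at hx
    gcongr

/-- Convergence in `L¹_loc` gives uniform `L¹` bounds on compact sets. -/
lemma TendstoLpLoc.exists_lintegral_abs_le {n : ℕ} {f : ℕ → (Fin n → ℂ) → EReal}
    {g : (Fin n → ℂ) → EReal} {μ : Measure (Fin n → ℂ)} {Ω : Set (Fin n → ℂ)}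
    (h : TendstoLpLoc f g 1 μ Ω) {K : Set (Fin n → ℂ)} (hK : IsCompact K) (hKΩ : K ⊆ Ω) :
    ∃ M : ℝ≥0∞, M ≠ ⊤ ∧ ∀ j, ∫⁻ z in K, (f j z).abs ∂μ ≤ M := by
  obtain ⟨hf, hg, hlim⟩ := h
  have hlim := hlim K hK hKΩ
  obtain ⟨hgm, hgi⟩ := hg K hK hKΩ
  simp only [ENNReal.rpow_one] at hlim hgi
  -- The tail is within `1` of the limit in `L¹`; the finitely many earlier norms are summed.
  obtain ⟨N, hN⟩ := eventually_atTop.1 (hlim.eventually_le_const one_pos)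
  refine ⟨(1 + ∫⁻ z in K, (g z).abs ∂μ) + ∑ j ∈ Finset.range N, ∫⁻ z in K, (f j z).abs ∂μ,
    ?_, fun j => ?_⟩
  · refine ENNReal.add_ne_top.2 ⟨by finiteness, (ENNReal.sum_lt_top.2 fun j _ => ?_).ne⟩
    simpa using (hf j K hK hKΩ).2
  · rcases lt_or_ge j N with hj | hj
    · refine le_trans ?_ le_add_self
      exact Finset.single_le_sum (f := fun j => ∫⁻ z in K, (f j z).abs ∂μ)
        (fun _ _ => zero_le) (Finset.mem_range.2 hj)
    · refine le_trans ?_ le_self_add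
      calc ∫⁻ z in K, (f j z).abs ∂μ
          ≤ ∫⁻ z in K, (f j z - g z).abs + (g z).abs ∂μ :=
            lintegral_mono fun z => EReal_abs_le_add_abs_sub _ _
        _ = ∫⁻ z in K, (f j z - g z).abs ∂μ + ∫⁻ z in K, (g z).abs ∂μ :=
            lintegral_add_right' _ (measurable_EReal_abs.comp_aemeasurable hgm)
        _ ≤ _ := by gcongr; exact hN j hj

/-- A uniform upper bound and a uniform exponential integral bound control the mass of `K` and
all `L^q` norms on `K`. -/
lemma lintegral_abs_rpow_le {X : Type*} [MeasurableSpace X] {μ : Measure X} {K : Set X}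
    (hK : MeasurableSet K) {f : ℕ → X → EReal} {M C : ℝ≥0∞} (hM : M ≠ ⊤) (hC : C ≠ ⊤) {α : ℝ}
    (hα : 0 < α) (hfM : ∀ j, ∀ z ∈ K, (f j z).toENNReal ≤ M)
    (hfC : ∀ j, ∫⁻ z in K, EReal.exp (-((α : EReal) * f j z)) ∂μ ≤ C) :
    μ K < ⊤ ∧ ∀ q : ℝ, 0 < q → ∃ B : ℝ≥0∞, B ≠ ⊤ ∧ ∀ j, ∫⁻ z in K, (f j z).abs ^ q ∂μ ≤ B := by
  have hμK : μ K < ⊤ := by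
    -- A single index suffices for the mass of `K`.
    have h1 : ENNReal.ofReal (Real.exp (-(α * M.toReal))) * μ K ≤ C := by
      rw [← setLIntegral_const]
      exact (setLIntegral_mono' hK fun z hz => ofReal_exp_neg_le hα hM (hfM 0 z hz)).trans (hfC 0)
    refine lt_top_iff_ne_top.2 fun h2 => hC (top_le_iff.1 ?_)
    rwa [h2, ENNReal.mul_top (by simpa using Real.exp_pos _)] at h1
  refine ⟨hμK, fun q hq => ⟨M ^ q * μ K + ENNReal.ofReal ((q / α) ^ q) * C, by finiteness,
    fun j => ?_⟩⟩
  calc ∫⁻ z in K, (f j z).abs ^ q ∂μ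
      ≤ ∫⁻ z in K, M ^ q + ENNReal.ofReal ((q / α) ^ q) * EReal.exp (-((α : EReal) * f j z)) ∂μ :=
        setLIntegral_mono' hK fun z hz => EReal_abs_rpow_le hα hq hM (hfM j z hz)
    _ = M ^ q * μ K +
        ENNReal.ofReal ((q / α) ^ q) * ∫⁻ z in K, EReal.exp (-((α : EReal) * f j z)) ∂μ := by
        rw [lintegral_add_left measurable_const, setLIntegral_const,
          lintegral_const_mul' _ _ ENNReal.ofReal_ne_top]
    _ ≤ _ := by gcongr; exact hfC j

end LocalLp

/-! ### The convergence theorem. -/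

theorem mainTheorem6 (n : ℕ) [NeZero n] (Ω : Set (Fin n → ℂ))
    (hΩ_open : IsOpen Ω) (hΩ_conn : IsConnected Ω) (hΩ_bdd : Bornology.IsBounded Ω)
    (hΩ_psc : LocalLp.IsPseudoconvex Ω) (hΩ_z : ∀ z ∈ Ω, ‖z 0‖ < Real.exp (-1))
    (γ : ℝ) (hγ0 : 0 ≤ γ) (hγ1 : γ < 1)
    (φj : ℕ → (Fin n → ℂ) → EReal) (φ : (Fin n → ℂ) → EReal)
    (hφj : ∀ j, LocalLp.IsPSH (φj j) Ω) (hφ : LocalLp.IsPSH φ Ω)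
    (hconv : LocalLp.TendstoLpLoc φj φ 1 volume Ω)
    (hint : ∃ α : ℝ, 0 < α ∧ ∀ E : Set (Fin n → ℂ), IsOpen E → IsCompact (closure E) →
      closure E ⊆ Ω → ∃ C : ℝ, 0 < C ∧ ∀ j,
        ∫⁻ z in E, EReal.exp (-((α : EReal) * φj j z)) ∂(LocalLp.muGamma Ω γ) < ENNReal.ofReal C) :
    ∀ p : ℝ, 1 ≤ p → LocalLp.TendstoLpLoc φj φ p (LocalLp.muGamma Ω γ) Ω := by
  obtain ⟨α, hα, hint⟩ := hint
  intro p hp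
  set w : (Fin n → ℂ) → ENNReal := fun z =>
    ENNReal.ofReal (1 / (‖z 0‖ ^ 2 * Real.log ((‖z 0‖ ^ 2)⁻¹) ^ (2 - γ)))
  have main : ∀ K : Set (Fin n → ℂ), IsCompact K → K ⊆ Ω →
      (∀ j, AEMeasurable (φj j) ((LocalLp.muGamma Ω γ).restrict K) ∧
        ∫⁻ z in K, (φj j z).abs ^ p ∂LocalLp.muGamma Ω γ < ⊤) ∧
      (AEMeasurable φ ((LocalLp.muGamma Ω γ).restrict K) ∧
        ∫⁻ z in K, (φ z).abs ^ p ∂LocalLp.muGamma Ω γ < ⊤) ∧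
      Tendsto (fun j => ∫⁻ z in K, (φj j z - φ z).abs ^ p ∂LocalLp.muGamma Ω γ) atTop (𝓝 0) := by
    intro K hK hKΩ
    have hμK : (LocalLp.muGamma Ω γ).restrict K = (volume.restrict K).withDensity w := by
      rw [LocalLp.muGamma, restrict_withDensity hK.measurableSet,
        Measure.restrict_restrict_of_subset hKΩ]
    have hac : (volume.restrict K).withDensity w ≪ volume.restrict K :=
      withDensity_absolutelyContinuous _ _
    obtain ⟨M, hM, hfM⟩ := LocalLp.exists_toENNReal_le_of_lintegral_abs_le hφj hΩ_open hK hKΩ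
      fun L hL hLΩ => hconv.exists_lintegral_abs_le hL hLΩ
    -- The exponential bound is given on open sets, so `K` is enclosed in one.
    obtain ⟨E, hE, hKE, hEΩ, hEc⟩ := exists_open_between_and_isCompact_closure hK hΩ_open hKΩ
    obtain ⟨C, -, hC⟩ := hint E hE hEc hEΩ
    obtain ⟨hfin, hb⟩ := LocalLp.lintegral_abs_rpow_le (μ := LocalLp.muGamma Ω γ)
      hK.measurableSet hM ENNReal.ofReal_ne_top hα hfM
      fun j => (lintegral_mono_set hKE).trans (hC j).le
    have hfinite : IsFiniteMeasure ((volume.restrict K).withDensity w) := by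
      rw [← hμK]
      exact ⟨by rwa [Measure.restrict_apply_univ]⟩
    rw [hμK] at hb ⊢
    have hfm := fun j => (hconv.1 j K hK hKΩ).1
    have hgm := (hconv.2.1 K hK hKΩ).1
    obtain ⟨h1, h2⟩ := lintegral_rpow_lt_top_and_tendsto
      (a := fun j z => (φj j z).abs) (h := fun j z => (φj j z - φ z).abs) (g := fun z => (φ z).abs)
      (fun j => LocalLp.measurable_EReal_abs.comp_aemeasurable (hfm j))
      (fun j => LocalLp.measurable_EReal_abs.comp_aemeasurable ((hfm j).sub hgm))
      (LocalLp.measurable_EReal_abs.comp_aemeasurable hgm)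
      (by simpa using hconv.2.2 K hK hKΩ)
      (fun j => ae_of_all _ fun z => LocalLp.EReal_abs_le_abs_add_abs_sub _ _)
      (fun j => ae_of_all _ fun z => LocalLp.EReal_abs_sub_le _ _)
      (fun q hq => hb q (by linarith)) hp
    obtain ⟨B, hB, hB'⟩ := hb p (by linarith)
    exact ⟨fun j => ⟨(hfm j).mono_ac hac, (hB' j).trans_lt hB.lt_top⟩,
      ⟨hgm.mono_ac hac, h1⟩, h2⟩
  exact ⟨fun j K hK hKΩ => (main K hK hKΩ).1 j, fun K hK hKΩ => (main K hK hKΩ).2.1,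
    fun K hK hKΩ => (main K hK hKΩ).2.2⟩
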